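/- **Model.** Let $G$ be a finite connected simple undirected graph with $n$ nodes, $m$ edges and maximum degree $\Delta$. The nodes are anonymous and have no memory; at each node $v$ the incident edges carry the port numbers $0,\dots,\deg(v)-1$, with no relation between the two port numbers of an edge. There are $k\le n$ deterministic robots with distinct labels $1,\dots,k$, placed initially at arbitrary nodes (several may share a node). A robot knows its label and $k$, but not $G,n,m,\Delta$; at a node it senses the degree, the port through which it entered, and the label of the robot docked there, if there is one. The system is asynchronous: robots execute their iterations and moves in an arbitrary interleaving. If several robots contend to dock at a free node, $\mathrm{MUTEX}$ lets exactly one of them (an arbitrary one) dock, and the others learn its label. A docked robot does not terminate: it stays at its node and relays its label to every visiting robot. **Algorithm Independent-Async** (robot $i$). Variables: $port\in\{-1,0,1,\dots\}$, initially $-1$; $state\in\{explore,backtrack,settled\}$, initially $explore$; a boolean array $visited[1..k]$, initially all $0$; a stack of ports, initially empty. Repeat the following iteration (each iteration ends by docking or by one move along an edge). Except in the first iteration, set $port$ to the port through which the node was entered. * $state=explore$: * if a robot $j$ with $visited[j]=1$ is docked at the node, set $state\gets backtrack$ and move through $port$; * if a robot $j$ with $visited[j]=0$ is docked at the node, set $visited[j]\gets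 1$, push $port$, set $port\gets(port+1)\bmod \deg$; if now $port$ equals the top of the stack, set $state\gets backtrack$ and pop; move through $port$; * if the node is free, call $\mathrm{MUTEX}$; if $i$ wins, it docks at the node ($state\gets settled$) and leaves the loop; if $r\ne i$ wins, proceed as in the previous case with $j=r$. * $state=backtrack$: set $port\gets(port+1)\bmod\deg$; if $port$ differs from the top of the stack, set $state\gets explore$, otherwise pop; move through $port$. **Theorem.** Algorithm Independent-Async solves dispersion (without termination) in the asynchronous model in $O(m)$ steps with $O(k\log\Delta)$ bits at each robot. Precisely: 1. In every execution, at any time at most one robot is docked at each node, and a docked robot stays docked at its node forever. If no robot is delayed forever, then after finitely many events a configuration is reached that no longer changes, in which all $k$ robots are docked, at pairwise distinct nodes. 2. In every execution, every robot makes at most $4m-2n+2$ moves along edges in total, and executes at most $\max(1,\,4m-2n+2)$ iterations, including the one in which it docks. 3. There is an absolute constant $C$ such that for all $k$ and $\Delta$, $C\,k\max(1,\log_2\Delta)$ bits at each robot suffice to store everything a robot ever has to store (its label and its variables), in all executions of $k$ robots on all connected graphs of maximum degree $\Delta$ with at least $k$ nodes. -/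

import Mathlib

/-! Dispersion of mobile robots on an anonymous port-labelled graph:
the asynchronous robot model and the algorithm Independent-Async. -/

universe u

namespace Dispersion

/-! ### The graph -/

/-- At every node `v` the incident edges are numbered by the ports `0, …, deg v - 1`.
The two port numbers of an edge are unrelated. -/
structure PortLabeling {V : Type u} [Fintype V] (G : SimpleGraph V) [DecidableRel G.Adj] where
  /-- `port v p` is the neighbour of `v` reached through port `p` of `v`. -/
  port : ∀ v : V, Fin (G.degree v) ≃ G.neighborSet v

/-- The node reached from `v` through port `p`, with the port by which that node is entered;
`none` if `v` has no port `p`. -/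
def PortLabeling.through {V : Type u} [Fintype V] {G : SimpleGraph V} [DecidableRel G.Adj]
    (P : PortLabeling G) (v : V) (p : ℤ) : Option (V × ℕ) :=
  if h : 0 ≤ p ∧ p < G.degree v then
    let w := P.port v ⟨p.toNat, by omega⟩
    some (w.1, ((P.port w.1).symm ⟨v, G.adj_symm w.2⟩).val)
  else none

/-! ### The code of a robot

Nothing in this part depends on the graph: a robot sees only its own label and memory, the degree
of the node where it is, its entry port, and the label relayed by the robot docked at the node. -/

/-- The variable `state`. -/
inductive Mode
  | explore
  | backtrack
  | settled
  deriving DecidableEq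

/-- The memory of an (undocked or docked) robot, when there are `k` robots. -/
structure Memory (k : ℕ) where
  /-- The variable `port_entered`; `-1` stands for "no port". -/
  portEntered : ℤ
  /-- The variable `state`. -/
  mode : Mode
  /-- The boolean array `visited`, indexed by the labels of the robots. -/
  visited : Fin k → Bool
  /-- The stack of ports; its top is the head of the list. -/
  stack : List ℤ
  /-- Program counter within an iteration: the robot has found its node free, has called
  MUTEX(node), and awaits the outcome. -/
  contending : Bool

/-- What a robot does at the end of a local computation. -/
inductive Action
  | stay
  | moveThrough (p : ℤ)

/-- The initial memory. -/
def Memory.init (k : ℕ) : Memory k where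
  portEntered := -1
  mode := .explore
  visited := fun _ => false
  stack := []
  contending := false

/-- First visit of the node where robot `j` is docked: mark `j`, push `port_entered`, go to the
next port; if that is the top of the stack, switch to backtracking and pop. Then move. -/
def firstVisit {k : ℕ} (M : Memory k) (degree : ℕ) (j : Fin k) : Memory k × Action :=
  let pushed := M.portEntered :: M.stack
  let q := (M.portEntered + 1) % (degree : ℤ)
  let M' : Memory k :=
    { M with visited := Function.update M.visited j true, portEntered := q, contending := false }
  if pushed.head? = some q then
    ({ M' with mode := .backtrack, stack := pushed.tail }, .moveThrough q)
  else
    ({ M' with stack := pushed }, .moveThrough q)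

/-- The beginning of an iteration of the main loop, up to the move, or up to the call of MUTEX.
`entry` is the entry port (`none` in the first iteration, where the robot has not moved yet), and
`docked` is the label of the robot docked at the node, if there is one. -/
def beginRound {k : ℕ} (M₀ : Memory k) (degree : ℕ) (entry : Option ℕ) (docked : Option (Fin k)) :
    Memory k × Action :=
  let M : Memory k := match entry with
    | none => M₀
    | some e => { M₀ with portEntered := (e : ℤ) }
  match M.mode with
  | .explore =>
    match docked with
    | some j =>
      if M.visited j = true then
        ({ M with mode := .backtrack }, .moveThrough M.portEntered)
      else
        firstVisit M degree j
    | none => ({ M with contending := true }, .stay)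
  | .backtrack =>
    let q := (M.portEntered + 1) % (degree : ℤ)
    if M.stack.head? ≠ some q then
      ({ M with portEntered := q, mode := .explore }, .moveThrough q)
    else
      ({ M with portEntered := q, stack := M.stack.tail }, .moveThrough q)
  | .settled => (M₀, .stay)

/-- The rest of the iteration of robot `i`, when MUTEX(node) has returned the winner `r`. -/
def afterMutex {k : ℕ} (i : Fin k) (M : Memory k) (degree : ℕ) (r : Fin k) : Memory k × Action :=
  if i = r then
    ({ M with mode := .settled, contending := false }, .stay)
  else
    firstVisit M degree r

/-! ### The asynchronous system -/

/-- Where a robot is. -/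
inductive Place (V : Type u)
  /-- At the node `v`, entered through the port `entry` (`none` if it started there and has not
  moved yet). -/
  | node (v : V) (entry : Option ℕ)
  /-- On its way along the edge that has port `p` at `v`, coming from `v`. -/
  | edge (v : V) (p : ℤ)

/-- The node at which a robot is, if it is at a node. -/
def Place.node? {V : Type u} : Place V → Option V
  | .node v _ => some v
  | .edge _ _ => none

/-- A configuration of `k` robots, whose labels are the elements of `Fin k`. -/
structure Config (V : Type u) (k : ℕ) where
  place : Fin k → Place V
  mem : Fin k → Memory k

/-- Robot `j` is docked at the node `v`. -/
def Config.DockedAt {V : Type u} {k : ℕ} (c : Config V k) (j : Fin k) (v : V) : Prop :=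
  (c.mem j).mode = .settled ∧ (c.place j).node? = some v

instance {V : Type u} [DecidableEq V] {k : ℕ} (c : Config V k) (j : Fin k) (v : V) :
    Decidable (c.DockedAt j v) := by
  unfold Config.DockedAt; infer_instance

/-- The label that a robot at `v` receives from the robot docked there, if there is one. -/
def Config.dockedRobot {V : Type u} [DecidableEq V] {k : ℕ} (c : Config V k) (v : V) :
    Option (Fin k) :=
  (List.finRange k).find? (fun j => decide (c.DockedAt j v))

/-- The initial configuration: robot `i` is at the node `start i`. -/
def Config.init {V : Type u} {k : ℕ} (start : Fin k → V) : Config V k where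
  place := fun i => .node (start i) none
  mem := fun _ => Memory.init k

/-- One activation of robot `i`.
A robot on an edge arrives at the other end. A robot that has called MUTEX gets the outcome: the
winner is the first contending robot to be served, and it docks at once. Any other undocked robot
at a node begins an iteration of the main loop. A docked robot stays, relaying its label. -/
def activate {V : Type u} [Fintype V] [DecidableEq V] {G : SimpleGraph V} [DecidableRel G.Adj]
    (P : PortLabeling G) {k : ℕ} (c : Config V k) (i : Fin k) : Config V k :=
  match c.place i with
  | .edge v p =>
    match P.through v p with
    | some (w, q) => { c with place := Function.update c.place i (.node w (some q)) }
    | none => c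
  | .node v entry =>
    if (c.mem i).mode = .settled then c
    else
      let out :=
        if (c.mem i).contending = true then
          afterMutex i (c.mem i) (G.degree v) ((c.dockedRobot v).getD i)
        else
          beginRound (c.mem i) (G.degree v) entry (c.dockedRobot v)
      { place := match out.2 with
          | .stay => c.place
          | .moveThrough p => Function.update c.place i (.edge v p)
        mem := Function.update c.mem i out.1 }

/-- The execution in which the robots are activated in the order `σ 0, σ 1, …`;
`run P start σ t` is the configuration after `t` activations. -/
def run {V : Type u} [Fintype V] [DecidableEq V] {G : SimpleGraph V} [DecidableRel G.Adj]
    (P : PortLabeling G) {k : ℕ} (start : Fin k → V) (σ : ℕ → Fin k) : ℕ → Config V k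
  | 0 => Config.init start
  | t + 1 => activate P (run P start σ t) (σ t)

/-- A schedule of the asynchronous system: arbitrary, except that no robot is delayed forever. -/
def Fair {k : ℕ} (σ : ℕ → Fin k) : Prop :=
  ∀ (i : Fin k) (t : ℕ), ∃ s, t ≤ s ∧ σ s = i

/-! ### Complexity measures -/

/-- Robot `i` is at a node, undocked, and at the beginning of an iteration of the main loop. -/
def Config.AtRoundStart {V : Type u} {k : ℕ} (c : Config V k) (i : Fin k) : Prop :=
  (c.place i).node?.isSome = true ∧ (c.mem i).mode ≠ .settled ∧ (c.mem i).contending = false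

open Classical in
/-- The number of iterations of the main loop that robot `i` begins in the first `t` activations. -/
noncomputable def rounds {V : Type u} [Fintype V] [DecidableEq V] {G : SimpleGraph V}
    [DecidableRel G.Adj] (P : PortLabeling G) {k : ℕ} (start : Fin k → V) (σ : ℕ → Fin k)
    (i : Fin k) (t : ℕ) : ℕ :=
  ((Finset.range t).filter
    (fun s => σ s = i ∧ (run P start σ s).AtRoundStart i)).card

open Classical in
/-- The number of moves along edges that robot `i` makes (or starts) in the first `t` activations. -/
noncomputable def moves {V : Type u} [Fintype V] [DecidableEq V] {G : SimpleGraph V}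
    [DecidableRel G.Adj] (P : PortLabeling G) {k : ℕ} (start : Fin k → V) (σ : ℕ → Fin k)
    (i : Fin k) (t : ℕ) : ℕ :=
  ((Finset.range t).filter
    (fun s => ((run P start σ s).place i).node?.isSome = true ∧
      ((run P start σ (s + 1)).place i).node? = none)).card

/-- Everything that a robot may ever have to store (its label and its memory), over all
executions of `k` robots on all connected graphs with maximum degree `Δ` and at least `k` nodes. -/
def storedStates (k Δ : ℕ) : Set (Fin k × Memory k) :=
  { x | ∃ (V : Type u) (_ : Fintype V) (_ : DecidableEq V) (G : SimpleGraph V)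
      (_ : DecidableRel G.Adj) (P : PortLabeling G) (start : Fin k → V) (σ : ℕ → Fin k)
      (i : Fin k) (t : ℕ),
      G.Connected ∧ k ≤ Fintype.card V ∧ G.maxDegree = Δ ∧ x = (i, (run P start σ t).mem i) }

/-- `B` bits at each robot suffice: everything that a robot may have to store has its own code
among the words of `B` bits. -/
def BitsSuffice (k Δ B : ℕ) : Prop :=
  ∃ code : Fin k × Memory k → (Fin B → Bool), Set.InjOn code (storedStates.{u} k Δ)

end Dispersion

/-!
A robot leaves a node only when another robot is docked there, and that robot stays for good. Hence
the labels of the docked robots identify the nodes that a given robot has left, and the walk of each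
robot, whatever the schedule, is the beginning of an ordinary depth-first traversal of `G`
(`Traversal`), whose branch of parent ports is stored on the stack. `Phase` relates the memory of a
robot to such a traversal, and `Phase.of_beginRound`, `Phase.of_firstVisit` show that each iteration
of the algorithm continues it. The traversal is never complete: the visited nodes hold distinct
robots other than the visiting one, so there are fewer than `k ≤ n` of them
(`Recorded.card_lt`), and the robot never runs out of ports at the root (`Traversal.eq_univ`).

*Steps.* Let `E` be the number of explorations made. No port is explored twice at a node, and the
parent ports of the nodes other than the root are not explored, so
`E ≤ ∑ v, (deg v - 1) + 1 = 2m - n + 1` (`Traversal.sum_cnt_le`). Every exploration is undone by at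
most one backtracking move, which gives `2E ≤ 4m - 2n + 2` moves; more precisely, the number of
moves is `2E` minus the length of the branch in state `explore`, and one more in state `backtrack`.
An iteration that ends by docking makes no move, but then the robot was exploring, which leaves room
for one more iteration.

*Dispersion.* An undocked robot is activated at most three times per iteration (`RobotInv.act_le`),
so in a fair execution every robot docks. It docks only at a free node
(`Activation.dockedAt_cases`).

*Memory.* The stack holds at most one port for each visited node, thus at most `k` ports, and all
its entries lie between `-1` and `Δ` (`Memory.Bounded`); so does the current port. Counting the
memories of this kind gives the bound on the number of bits (`card_stateCode_le`).
-/

namespace Dispersion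

/-! ### Ports -/

section Graph

variable {V : Type u} [Fintype V] {G : SimpleGraph V} [DecidableRel G.Adj] (P : PortLabeling G)

theorem PortLabeling.through_port_symm {v : V} (w : G.neighborSet v) :
    P.through v (((P.port v).symm w).val : ℤ) =
      some (w.1, ((P.port w.1).symm ⟨v, G.adj_symm w.2⟩).val) := by
  obtain ⟨p, rfl⟩ := (P.port v).surjective w
  rw [Equiv.symm_apply_apply, PortLabeling.through,
    dif_pos ⟨by positivity, by exact_mod_cast p.isLt⟩]
  simp

theorem PortLabeling.through_of_adj {v w : V} (h : G.Adj v w) :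
    ∃ (p : ℤ) (q : ℕ), P.through v p = some (w, q) :=
  ⟨_, _, P.through_port_symm ⟨w, h⟩⟩

theorem PortLabeling.exists_through {v : V} {p : ℤ} (h0 : 0 ≤ p) (h : p < G.degree v) :
    ∃ w q, P.through v p = some (w, q) := by
  rw [PortLabeling.through, dif_pos ⟨h0, h⟩]
  exact ⟨_, _, rfl⟩

variable {P}

theorem PortLabeling.bounds_of_through {v w : V} {p : ℤ} {q : ℕ} (h : P.through v p = some (w, q)) :
    0 ≤ p ∧ p < G.degree v := by
  unfold PortLabeling.through at h
  split_ifs at h with h'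
  exact h'

theorem PortLabeling.through_symm {v w : V} {p : ℤ} {q : ℕ} (h : P.through v p = some (w, q)) :
    P.through w q = some (v, p.toNat) := by
  have hb := PortLabeling.bounds_of_through h
  unfold PortLabeling.through at h
  rw [dif_pos hb] at h
  simp only [Option.some.injEq, Prod.mk.injEq] at h
  obtain ⟨rfl, rfl⟩ := h
  rw [P.through_port_symm]
  exact congrArg (fun i : Fin _ => some (v, i.val))
    ((P.port v).symm_apply_apply ⟨p.toNat, by omega⟩)

theorem PortLabeling.entry_lt {v w : V} {p : ℤ} {q : ℕ} (h : P.through v p = some (w, q)) :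
    q < G.degree w := by
  exact_mod_cast (PortLabeling.bounds_of_through (PortLabeling.through_symm h)).2

/-! ### Depth-first traversals -/

variable (G) in
/-- The port through which `v` was left last, when the search entered `v` through `par v` and has
since tried `cnt v` ports in cyclic order. -/
def lastPort (par : V → ℤ) (cnt : V → ℕ) (v : V) : ℤ := (par v + cnt v) % (G.degree v : ℤ)

variable (P) in
/-- `Branch P r par cnt l`: the list `l` is the current branch of the search tree, from the current
node down to the root `r`; the parent port of each node leads to the next one, and enters it through
the port by which that node was left last. -/
inductive Branch (r : V) (par : V → ℤ) (cnt : V → ℕ) : List V → Prop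
  | root : Branch r par cnt [r]
  | cons {u v : V} {l : List V} : u ∉ v :: l →
      P.through u (par u) = some (v, (lastPort G par cnt v).toNat) →
      Branch r par cnt (v :: l) → Branch r par cnt (u :: v :: l)

namespace Branch

variable {r : V} {par par' : V → ℤ} {cnt cnt' : V → ℕ}

theorem root_mem {l : List V} (h : Branch P r par cnt l) : r ∈ l := by
  induction h with
  | root => simp
  | cons _ _ _ ih => exact List.mem_cons_of_mem _ ih

theorem nodup {l : List V} (h : Branch P r par cnt l) : l.Nodup := by
  induction h with
  | root => simp
  | cons hu _ _ ih => exact List.nodup_cons.2 ⟨hu, ih⟩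

theorem eq_nil_of_root {l : List V} (h : Branch P r par cnt (r :: l)) : l = [] := by
  cases h with
  | root => rfl
  | cons hu _ h => exact absurd h.root_mem hu

theorem congr {l : List V} (h : Branch P r par cnt l) (hp : ∀ v ∈ l, par' v = par v)
    (hc : ∀ v ∈ l.tail, cnt' v = cnt v) : Branch P r par' cnt' l := by
  induction h with
  | root => exact .root
  | @cons u v l hu ht _ ih =>
    refine .cons hu ?_ (ih (fun w hw => hp w (List.mem_cons_of_mem _ hw))
      (fun w hw => hc w (List.mem_of_mem_tail hw)))
    rw [hp u (by simp), ht, lastPort, lastPort, hp v (by simp), hc v (by simp)]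

end Branch

variable (P) in
/-- State of a depth-first search from `r` that uses the ports of every node in cyclic order,
starting after the parent port. `S` is the set of visited nodes, `par v` the port through which `v`
was first entered (`-1` at the root), `cnt v` the number of ports of `v` that have been explored
(which are `par v + 1, …, par v + cnt v` modulo the degree), `path` the current branch, and `x` the
node that the search is about to enter. -/
structure Traversal (r : V) (S : Finset V) (par : V → ℤ) (cnt : V → ℕ) (path : List V) (x : V) :
    Prop where
  cnt_eq_zero : ∀ v ∉ S, cnt v = 0
  par_root : par r = -1
  par_spec : ∀ v ∈ S, v ≠ r → ∃ u ∈ S, ∃ l, P.through v (par v) = some (u, l)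
  cnt_lt : ∀ v ∈ S, v ≠ r → cnt v < G.degree v
  cnt_root : cnt r ≤ G.degree r
  closed : ∀ v ∈ S, ∀ j < cnt v, ∀ u l,
    P.through v ((par v + 1 + j) % (G.degree v : ℤ)) = some (u, l) → u ∈ S ∨ u = x
  finished : ∀ v ∈ S, v ∉ path → cnt v + 1 = G.degree v
  branch : Branch P r par cnt path
  path_subset : ∀ v ∈ path, v ∈ S

namespace Traversal

variable {r : V} {S : Finset V} {par : V → ℤ} {cnt : V → ℕ} {path : List V} {x : V}

theorem root_mem (T : Traversal P r S par cnt path x) : r ∈ S :=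
  T.path_subset r T.branch.root_mem

variable (P) in
theorem start (r : V) : Traversal P r {r} (fun _ => -1) (fun _ => 0) [r] r where
  cnt_eq_zero _ _ := rfl
  par_root := rfl
  par_spec v hv hvr := absurd (Finset.mem_singleton.1 hv) hvr
  cnt_lt v hv hvr := absurd (Finset.mem_singleton.1 hv) hvr
  cnt_root := Nat.zero_le _
  closed v _ j hj := absurd hj (Nat.not_lt_zero j)
  finished v hv hvr := absurd (by simpa using hv) hvr
  branch := .root
  path_subset v hv := by simpa using hv

/-- When a node is entered that has been visited before, the search may turn to any other node. -/
theorem retarget (T : Traversal P r S par cnt path x) (hx : x ∈ S) (y : V) :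
    Traversal P r S par cnt path y :=
  { T with
    closed := fun v hv j hj u l h => by
      rcases T.closed v hv j hj u l h with h | rfl
      · exact .inl h
      · exact .inl hx }

theorem par_bounds (T : Traversal P r S par cnt path x) {v : V} (hv : v ∈ S) :
    -1 ≤ par v ∧ par v ≤ G.degree v := by
  by_cases h : v = r
  · subst h
    rw [T.par_root]
    omega
  · obtain ⟨u, -, l, hl⟩ := T.par_spec v hv h
    have := PortLabeling.bounds_of_through hl
    omega

/-- The search enters a new node `w`, from the top `v` of the branch. -/
theorem push [DecidableEq V] {v w : V} {rest : List V} {q : ℕ}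
    (T : Traversal P r S par cnt (v :: rest) w) (hw : w ∉ S)
    (h : P.through v (lastPort G par cnt v) = some (w, q)) :
    Traversal P r (insert w S) (Function.update par w q) cnt (w :: v :: rest) w := by
  have hsymm := PortLabeling.through_symm h
  have hv : v ∈ S := T.path_subset v (by simp)
  have hlt := PortLabeling.entry_lt h
  have hup : ∀ u ∈ S, Function.update par w (q : ℤ) u = par u := fun u hu =>
    Function.update_of_ne (fun h : u = w => hw (h ▸ hu)) _ _
  refine ⟨fun u hu => T.cnt_eq_zero u fun h => hu (Finset.mem_insert_of_mem h), ?_, ?_, ?_,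
    T.cnt_root, ?_, ?_, ?_, ?_⟩
  · rw [hup r T.root_mem, T.par_root]
  · intro u hu hur
    rcases Finset.mem_insert.1 hu with rfl | hu
    · exact ⟨v, Finset.mem_insert_of_mem hv, _, by rw [Function.update_self]; exact hsymm⟩
    · obtain ⟨a, ha, l, hl⟩ := T.par_spec u hu hur
      exact ⟨a, Finset.mem_insert_of_mem ha, l, by rw [hup u hu]; exact hl⟩
  · intro u hu hur
    rcases Finset.mem_insert.1 hu with rfl | hu
    · rw [T.cnt_eq_zero u hw]; omega
    · exact T.cnt_lt u hu hur
  · intro u hu j hj a l hl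
    rcases Finset.mem_insert.1 hu with rfl | hu
    · rw [T.cnt_eq_zero u hw] at hj; omega
    · rw [hup u hu] at hl
      rcases T.closed u hu j hj a l hl with h | h
      · exact .inl (Finset.mem_insert_of_mem h)
      · exact .inr h
  · intro u hu hup
    simp only [List.mem_cons, not_or] at hup
    exact T.finished u (Finset.mem_of_mem_insert_of_ne hu hup.1) (by simp [hup.2])
  · refine .cons (fun h => hw (T.path_subset w h)) ?_
      (T.branch.congr (fun u hu => hup u (T.path_subset u hu)) fun _ _ => rfl)
    rw [Function.update_self, hsymm, lastPort, lastPort, hup v hv]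
  · intro u hu
    rcases List.mem_cons.1 hu with rfl | hu
    · exact Finset.mem_insert_self _ _
    · exact Finset.mem_insert_of_mem (T.path_subset u hu)

/-- The search explores the next port of the top `v` of the branch. -/
theorem advance [DecidableEq V] {v w : V} {rest : List V} {q : ℕ}
    (T : Traversal P r S par cnt (v :: rest) x) (hx : x ∈ S)
    (hlt : if v = r then cnt v < G.degree v else cnt v + 1 < G.degree v)
    (h : P.through v ((par v + cnt v + 1) % (G.degree v : ℤ)) = some (w, q)) :
    Traversal P r S par (Function.update cnt v (cnt v + 1)) (v :: rest) w := by
  have hv : v ∈ S := T.path_subset v (by simp)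
  have hnd := List.nodup_cons.1 T.branch.nodup
  refine ⟨?_, T.par_root, T.par_spec, ?_, ?_, ?_, ?_, ?_, T.path_subset⟩
  · intro u hu
    rw [Function.update_of_ne (fun h : u = v => hu (h ▸ hv)), T.cnt_eq_zero u hu]
  · intro u hu hur
    by_cases huv : u = v
    · subst huv
      rw [Function.update_self]
      rwa [if_neg hur] at hlt
    · rw [Function.update_of_ne huv]
      exact T.cnt_lt u hu hur
  · by_cases hrv : v = r
    · subst hrv
      rw [if_pos rfl] at hlt
      rw [Function.update_self]
      omega
    · rw [Function.update_of_ne (Ne.symm hrv)]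
      exact T.cnt_root
  · intro u hu j hj a l hl
    have hold : j < cnt u → a ∈ S ∨ a = w := fun hj => by
      rcases T.closed u hu j hj a l hl with h | rfl
      · exact .inl h
      · exact .inl hx
    by_cases huv : u = v
    · subst huv
      rw [Function.update_self] at hj
      rcases Nat.lt_succ_iff_lt_or_eq.1 hj with hj | rfl
      · exact hold hj
      · rw [show par u + 1 + (cnt u : ℤ) = par u + cnt u + 1 by ring, h] at hl
        simp only [Option.some.injEq, Prod.mk.injEq] at hl
        exact .inr hl.1.symm
    · rw [Function.update_of_ne huv] at hj
      exact hold hj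
  · intro u hu hup
    rw [Function.update_of_ne (fun h : u = v => hup (h ▸ List.mem_cons_self))]
    exact T.finished u hu hup
  · exact T.branch.congr (fun _ _ => rfl) fun u hu =>
      Function.update_of_ne (fun h : u = v => hnd.1 (h ▸ hu)) _ _

/-- The search leaves the top `v` of the branch for good. -/
theorem pop {v u : V} {rest : List V} (T : Traversal P r S par cnt (v :: u :: rest) x)
    (h : cnt v + 1 = G.degree v) : Traversal P r S par cnt (u :: rest) x :=
  { T with
    finished := fun a ha hap => by
      by_cases hav : a = v
      · exact hav ▸ h
      · exact T.finished a ha (by simpa [hav] using hap)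
    branch := by
      cases T.branch with
      | cons _ _ hb => exact hb
    path_subset := fun a ha => T.path_subset a (List.mem_cons_of_mem _ ha) }

/-- All neighbours of a node are visited when its ports have been used up. -/
theorem neighbor_mem [DecidableEq V] (T : Traversal P r S par cnt path x) (hx : x ∈ S) {v u : V}
    (hv : v ∈ S) (hcnt : if v = r then cnt v = G.degree v else cnt v + 1 = G.degree v)
    (h : G.Adj v u) :
    u ∈ S := by
  obtain ⟨p, q, hp⟩ := P.through_of_adj h
  obtain ⟨hp0, hpd⟩ := PortLabeling.bounds_of_through hp
  by_cases hpar : v ≠ r ∧ p = par v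
  · obtain ⟨a, ha, l, hl⟩ := T.par_spec v hv hpar.1
    rw [← hpar.2, hp] at hl
    simp only [Option.some.injEq, Prod.mk.injEq] at hl
    exact hl.1 ▸ ha
  -- the position of `p` in the cyclic order that starts after the parent port
  obtain ⟨j, hj⟩ := Int.eq_ofNat_of_zero_le
    (Int.emod_nonneg (p - par v - 1) (show (G.degree v : ℤ) ≠ 0 by omega))
  have hjd := Int.emod_lt_of_pos (p - par v - 1) (show 0 < (G.degree v : ℤ) by omega)
  have hport : (par v + 1 + j) % (G.degree v : ℤ) = p := by
    rw [← hj, Int.add_emod_emod, show par v + 1 + (p - par v - 1) = p by ring]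
    exact Int.emod_eq_of_lt hp0 hpd
  have hjc : j < cnt v := by
    split_ifs at hcnt with hvr
    · omega
    · by_contra hcon
      have hje : (j : ℤ) = G.degree v - 1 := by omega
      obtain ⟨a, -, l, hl⟩ := T.par_spec v hv hvr
      obtain ⟨hb0, hbd⟩ := PortLabeling.bounds_of_through hl
      rw [hje, show par v + 1 + ((G.degree v : ℤ) - 1) = par v + G.degree v by ring,
        Int.add_emod_right, Int.emod_eq_of_lt hb0 hbd] at hport
      exact hpar ⟨hvr, hport.symm⟩
  rcases T.closed v hv j hjc u q (by rw [hport]; exact hp) with h | rfl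
  · exact h
  · exact hx

/-- A search that has come back to the root and has used up the ports there has visited all
nodes. -/
theorem eq_univ [DecidableEq V] (T : Traversal P r S par cnt [r] x) (hx : x ∈ S) (hG : G.Connected)
    (hcnt : cnt r = G.degree r) : S = Finset.univ := by
  have hstep : ∀ {v u : V}, v ∈ S → G.Adj v u → u ∈ S := fun {v u} hv h => by
    refine T.neighbor_mem hx hv ?_ h
    split_ifs with hvr
    · rw [hvr, hcnt]
    · exact T.finished v hv (by simpa using hvr)
  refine Finset.eq_univ_iff_forall.2 fun u => ?_
  obtain ⟨W⟩ := hG.preconnected r u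
  have : ∀ {a b : V}, G.Walk a b → a ∈ S → b ∈ S := by
    intro a b W
    induction W with
    | nil => exact id
    | cons h _ ih => exact fun ha => ih (hstep ha h)
  exact this W T.root_mem

theorem nontrivial (T : Traversal P r S par cnt path x) (hS : S ≠ Finset.univ) :
    Nontrivial V := by
  obtain ⟨v, hv⟩ : ∃ v, v ∉ S := by
    by_contra! h
    exact hS (Finset.eq_univ_iff_forall.2 h)
  exact ⟨r, v, fun h => hv (h ▸ T.root_mem)⟩

theorem degree_pos (T : Traversal P r S par cnt path x) (hS : S ≠ Finset.univ)
    (hG : G.Connected) (v : V) : 0 < G.degree v :=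
  have := T.nontrivial hS
  hG.preconnected.degree_pos_of_nontrivial v

/-- The number of explorations: a node other than the root is never explored through its parent
port. -/
theorem sum_cnt_le [DecidableEq V] (T : Traversal P r S par cnt path x) (hS : S ≠ Finset.univ)
    (hG : G.Connected) : ∑ v, cnt v + Fintype.card V ≤ 2 * G.edgeFinset.card + 1 := by
  have hle : ∀ v, cnt v + 1 ≤ G.degree v + if v = r then 1 else 0 := fun v => by
    have hpos := T.degree_pos hS hG v
    split_ifs with hvr
    · have := T.cnt_root
      subst hvr
      omega
    · by_cases hv : v ∈ S
      · exact T.cnt_lt v hv hvr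
      · rw [T.cnt_eq_zero v hv]; omega
  have := Finset.sum_le_sum fun v (_ : v ∈ Finset.univ) => hle v
  rw [Finset.sum_add_distrib, Finset.sum_add_distrib, G.sum_degrees_eq_twice_card_edges] at this
  simpa using this

end Traversal

end Graph

/-! ### The walk of a robot as a depth-first traversal -/

section Walk

variable {V : Type u} {k : ℕ}

/-- The array `visited` describes the set `S` of nodes, when `D j v` says that robot `j` is docked
at `v`. -/
structure Recorded (D : Fin k → V → Prop) (visited : Fin k → Bool) (S : Finset V) : Prop where
  docked : ∀ v ∈ S, ∃ j, D j v ∧ visited j = true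
  marked : ∀ j, visited j = true → ∃ v ∈ S, D j v

namespace Recorded

variable {D D' : Fin k → V → Prop} {visited : Fin k → Bool} {S : Finset V}

theorem mono (R : Recorded D visited S) (h : ∀ j v, D j v → D' j v) : Recorded D' visited S where
  docked v hv := by
    obtain ⟨j, hj, hm⟩ := R.docked v hv
    exact ⟨j, h j v hj, hm⟩
  marked j hj := by
    obtain ⟨v, hv, hd⟩ := R.marked j hj
    exact ⟨v, hv, h j v hd⟩

theorem insert [DecidableEq V] (R : Recorded D visited S) {j : Fin k} {w : V} (h : D j w) :
    Recorded D (Function.update visited j true) (insert w S) where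
  docked v hv := by
    rcases Finset.mem_insert.1 hv with rfl | hv
    · exact ⟨j, h, Function.update_self ..⟩
    · obtain ⟨a, ha, hm⟩ := R.docked v hv
      refine ⟨a, ha, ?_⟩
      by_cases haj : a = j
      · rw [haj, Function.update_self]
      · rw [Function.update_of_ne haj, hm]
  marked a ha := by
    by_cases haj : a = j
    · exact ⟨w, Finset.mem_insert_self _ _, haj ▸ h⟩
    · rw [Function.update_of_ne haj] at ha
      obtain ⟨v, hv, hd⟩ := R.marked a ha
      exact ⟨v, Finset.mem_insert_of_mem hv, hd⟩

/-- Each visited node holds a robot of its own, and none of them is the visiting robot. -/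
theorem card_lt (R : Recorded D visited S) (hD : ∀ j v w, D j v → D j w → v = w) {i : Fin k}
    (hi : ∀ v, ¬ D i v) : S.card < k := by
  choose f hf _ using R.docked
  have hcard : S.attach.card ≤ (Finset.univ.erase i).card :=
    Finset.card_le_card_of_injOn (fun v => f v.1 v.2)
      (fun v _ => Finset.mem_coe.2 (Finset.mem_erase.2
        ⟨fun h => hi v.1 (h ▸ hf v.1 v.2), Finset.mem_univ _⟩))
      fun v _ w _ h => Subtype.ext (hD _ _ _ (hf v.1 v.2)
        (by simp only at h; rw [h]; exact hf w.1 w.2))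
  rw [Finset.card_attach, Finset.card_erase_of_mem (Finset.mem_univ _), Finset.card_fin] at hcard
  have := i.pos
  omega

end Recorded

/-- The value of `portEntered` at a node with entry port `entry`. -/
def entryPort : Option ℕ → ℤ
  | none => -1
  | some e => e

variable [Fintype V] {G : SimpleGraph V} [DecidableRel G.Adj]

/-- `Phase P r D M w entry mv`: a robot that started at `r`, has memory `M`, has made or begun `mv`
moves, and is at the node `w` (entered by the port `entry`) or on its way to it, is executing a
depth-first traversal of the graph, where `D j v` says that robot `j` is docked at `v`.
Twice the number of explorations exceeds the number of moves by the length of the branch in state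
`explore`, and by one less in state `backtrack`. -/
inductive Phase (P : PortLabeling G) (r : V) (D : Fin k → V → Prop) (M : Memory k) :
    V → Option ℕ → ℕ → Prop
  /-- The robot has not left its initial node. -/
  | fresh : M.mode = .explore → M.stack = [] → M.portEntered = -1 →
      (∀ j, M.visited j = false) → Phase P r D M r none 0
  /-- The robot explores the edge from the top `v` of the branch to `w`. -/
  | exploring {S : Finset V} {par : V → ℤ} {cnt : V → ℕ} {v w : V} {rest : List V} {q mv : ℕ} :
      Traversal P r S par cnt (v :: rest) w → Recorded D M.visited S →
      P.through v (lastPort G par cnt v) = some (w, q) → (M.contending = true → w ∉ S) →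
      M.mode = .explore → M.stack = (v :: rest).map par →
      mv + (rest.length + 1) = 2 * ∑ v, cnt v → Phase P r D M w (some q) mv
  /-- The robot returns to the top `v` of the branch, through the edge explored last there. -/
  | returning {S : Finset V} {par : V → ℤ} {cnt : V → ℕ} {v : V} {rest : List V} {mv : ℕ} :
      Traversal P r S par cnt (v :: rest) v → Recorded D M.visited S →
      M.contending = false → M.mode = .backtrack → M.stack = (v :: rest).map par →
      mv + (rest.length + 1) = 2 * ∑ v, cnt v + 1 →
      Phase P r D M v (some (lastPort G par cnt v).toNat) mv

variable {P : PortLabeling G} {r : V} {D D' : Fin k → V → Prop} {M M' : Memory k} {w : V}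
  {entry : Option ℕ} {mv : ℕ}

namespace Phase

theorem mono (H : Phase P r D M w entry mv) (h : ∀ j v, D j v → D' j v) :
    Phase P r D' M w entry mv := by
  cases H with
  | fresh h1 h2 h3 h4 => exact .fresh h1 h2 h3 h4
  | exploring T R h1 h2 h3 h4 h5 => exact .exploring T (R.mono h) h1 h2 h3 h4 h5
  | returning T R h1 h2 h3 h4 => exact .returning T (R.mono h) h1 h2 h3 h4

theorem mode_ne_settled (H : Phase P r D M w entry mv) : M.mode ≠ .settled := by
  cases H <;> simp_all

/-- At its new location the robot records the entry port. -/
theorem record_entry (H : Phase P r D M w entry mv) :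
    Phase P r D { M with portEntered := entryPort entry } w entry mv := by
  cases H with
  | fresh h1 h2 h3 h4 => exact .fresh h1 h2 rfl h4
  | exploring T R h1 h2 h3 h4 h5 => exact .exploring T R h1 h2 h3 h4 h5
  | returning T R h1 h2 h3 h4 => exact .returning T R h1 h2 h3 h4

/-- A step of the depth-first traversal: from the top `v` of the branch the robot moves through the
next port. If that is the parent port, `v` is finished. -/
theorem next [DecidableEq V] {S : Finset V} {par : V → ℤ} {cnt : V → ℕ} {v : V} {rest : List V}
    (hG : G.Connected) (T : Traversal P r S par cnt (v :: rest) v) (R : Recorded D M.visited S)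
    (hS : S ≠ Finset.univ) (hc : M.contending = false) {q : ℤ}
    (hq : q = (par v + cnt v + 1) % (G.degree v : ℤ))
    (hmv : mv + (rest.length + 1) = 2 * ∑ v, cnt v + 1) :
    ∃ w e, P.through v q = some (w, e) ∧
      (q ≠ par v → M.mode = .explore → M.stack = (v :: rest).map par →
        Phase P r D M w (some e) (mv + 1)) ∧
      (q = par v → M.mode = .backtrack → M.stack = rest.map par →
        Phase P r D M w (some e) (mv + 1)) := by
  have hd := T.degree_pos hS hG v
  have hv : v ∈ S := T.path_subset v (by simp)
  have hq0 : 0 ≤ q := hq ▸ Int.emod_nonneg _ (by omega)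
  have hqd : q < G.degree v := hq ▸ Int.emod_lt_of_pos _ (by omega)
  by_cases hqp : q = par v
  · have hvr : v ≠ r := fun h => by
      have := T.par_root
      rw [h] at hqp
      omega
    have hlt := T.cnt_lt v hv hvr
    -- in cyclic order the parent port comes last
    have hcnt : cnt v + 1 = G.degree v := by
      by_contra hne
      have h1 : ((cnt v : ℤ) + 1) % (G.degree v : ℤ) = 0 := by
        have h2 : (par v + ((cnt v : ℤ) + 1)) % (G.degree v : ℤ) = par v % G.degree v := by
          rw [← add_assoc, ← hq, ← hqp, Int.emod_eq_of_lt hq0 hqd]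
        have h3 := Int.ModEq.dvd (show par v ≡ par v + ((cnt v : ℤ) + 1) [ZMOD G.degree v] from
          h2.symm)
        exact Int.emod_eq_zero_of_dvd (by simpa using h3)
      rw [Int.emod_eq_of_lt (by omega) (by omega)] at h1
      omega
    have hb := T.branch
    cases hb with
    | root => exact absurd rfl hvr
    | @cons _ u l _ ht _ =>
      refine ⟨u, _, by rw [hqp]; exact ht, fun h => absurd hqp h, fun _ hm hs => ?_⟩
      refine .returning ((T.pop hcnt).retarget hv u) R hc hm hs ?_
      simp only [List.length_cons] at hmv ⊢
      omega
  · obtain ⟨w, e, hw⟩ := P.exists_through hq0 hqd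
    refine ⟨w, e, hw, fun _ hm hs => ?_, fun h => absurd h hqp⟩
    have hlt : if v = r then cnt v < G.degree v else cnt v + 1 < G.degree v := by
      split_ifs with hvr
      · subst hvr
        -- the root cannot be finished, as there are nodes that have not been visited
        refine lt_of_le_of_ne T.cnt_root fun hcnt => hS ?_
        have := T.branch.eq_nil_of_root
        subst this
        exact T.eq_univ hv hG hcnt
      · refine lt_of_le_of_ne (T.cnt_lt v hv hvr) fun hcnt => hqp ?_
        obtain ⟨a, -, l, hl⟩ := T.par_spec v hv hvr
        obtain ⟨hb0, hbd⟩ := PortLabeling.bounds_of_through hl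
        rw [hq, show par v + cnt v + 1 = par v + G.degree v by omega, Int.add_emod_right,
          Int.emod_eq_of_lt hb0 hbd]
    refine .exploring (T.advance hv hlt (hq ▸ hw)) R ?_ (by simp [hc]) hm hs ?_
    · rw [lastPort, Function.update_self, ← hw, hq]
      push_cast
      rw [← add_assoc]
    · rw [Finset.sum_update_of_mem (Finset.mem_univ v)]
      have := Finset.add_sum_erase Finset.univ cnt (Finset.mem_univ v)
      rw [← Finset.sdiff_singleton_eq_erase] at this
      omega

/-- A robot that finds a docked robot which it has not met before moves on in its traversal. -/
theorem of_firstVisit [DecidableEq V] (hG : G.Connected)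
    (hS : ∀ visited S, Recorded D visited S → S ≠ Finset.univ)
    (hD : ∀ i j v, D i v → D j v → i = j)
    (H : Phase P r D M w entry mv) (hm : M.mode = .explore) (hp : M.portEntered = entryPort entry)
    {j : Fin k} (hj : D j w) (hvis : M.visited j = false) :
    ∃ (M' : Memory k) (w' : V) (e : ℕ),
      firstVisit M (G.degree w) j = (M', .moveThrough M'.portEntered) ∧
      P.through w M'.portEntered = some (w', e) ∧
      M'.contending = false ∧ Phase P r D M' w' (some e) (mv + 1) := by
  -- after the entry port has been pushed, the traversal is at the top `w` of its branch
  obtain ⟨S, par, cnt, rest, T, R, hstack, hpar, hcnt, hmv⟩ : ∃ S par cnt rest,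
      Traversal P r S par cnt (w :: rest) w ∧
      Recorded D (Function.update M.visited j true) S ∧
      M.stack = rest.map par ∧ par w = M.portEntered ∧ cnt w = 0 ∧
      mv + (rest.length + 1) = 2 * ∑ v, cnt v + 1 := by
    cases H with
    | fresh h1 h2 h3 h4 =>
      refine ⟨{r}, fun _ => -1, fun _ => 0, [], Traversal.start P r, ?_, by simpa using h2,
        h3.symm, rfl, by simp⟩
      have hR : Recorded D M.visited ∅ := ⟨by simp, by simp [h4]⟩
      simpa using hR.insert hj
    | @exploring S par cnt v _ rest q _ T R h1 h2 h3 h4 h5 =>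
      have hw : w ∉ S := fun hw => by
        obtain ⟨a, ha, hva⟩ := R.docked w hw
        rw [hD a j w ha hj, hvis] at hva
        cases hva
      refine ⟨_, _, _, _, T.push hw h1, R.insert hj, ?_, ?_, T.cnt_eq_zero w hw, ?_⟩
      · rw [h4]
        refine List.map_congr_left fun u hu => ?_
        rw [Function.update_of_ne (fun h : u = w => hw (h ▸ T.path_subset u hu))]
      · rw [Function.update_self, hp]
        rfl
      · simp only [List.length_cons]
        omega
    | returning T R h1 h2 h3 h4 => simp [hm] at h2
  by_cases hq : (M.portEntered + 1) % (G.degree w : ℤ) = M.portEntered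
  · let M' : Memory k :=
      { portEntered := (M.portEntered + 1) % (G.degree w : ℤ), mode := .backtrack,
        visited := Function.update M.visited j true, stack := M.stack, contending := false }
    obtain ⟨w', e, hw', -, hP⟩ := next (M := M') (q := (M.portEntered + 1) % (G.degree w : ℤ))
      hG T R (hS _ _ R) rfl (by rw [hpar, hcnt]; simp) hmv
    refine ⟨M', w', e, ?_, hw', rfl, hP (by rw [hq, hpar]) rfl hstack⟩
    simp [firstVisit, hq, M']
  · let M' : Memory k :=
      { portEntered := (M.portEntered + 1) % (G.degree w : ℤ), mode := M.mode,
        visited := Function.update M.visited j true, stack := M.portEntered :: M.stack,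
        contending := false }
    obtain ⟨w', e, hw', hP, -⟩ := next (M := M') (q := (M.portEntered + 1) % (G.degree w : ℤ))
      hG T R (hS _ _ R) rfl (by rw [hpar, hcnt]; simp) hmv
    refine ⟨M', w', e, ?_, hw', rfl, hP (by rwa [hpar]) hm (by simp [M', hstack, hpar])⟩
    simp [firstVisit, Ne.symm hq, M']

/-- The beginning of an iteration, once the robot has recorded its entry port. -/
theorem of_beginRound_none [DecidableEq V] {N : Memory k} (hG : G.Connected)
    (hS : ∀ visited S, Recorded D visited S → S ≠ Finset.univ)
    (hD : ∀ j v w, D j v → D j w → v = w) (hD' : ∀ i j v, D i v → D j v → i = j)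
    (HN : Phase P r D N w entry mv) (hNc : N.contending = false)
    (hNp : N.portEntered = entryPort entry) {docked : Option (Fin k)}
    (hsome : ∀ j, docked = some j → D j w) (hnone : docked = none → ∀ j, ¬ D j w) :
    (∃ M' : Memory k, beginRound N (G.degree w) none docked = (M', .stay) ∧
      M'.contending = true ∧ M'.portEntered = entryPort entry ∧ Phase P r D M' w entry mv) ∨
    ∃ (M' : Memory k) (w' : V) (e : ℕ),
      beginRound N (G.degree w) none docked = (M', .moveThrough M'.portEntered) ∧
      P.through w M'.portEntered = some (w', e) ∧
      M'.contending = false ∧ Phase P r D M' w' (some e) (mv + 1) := by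
  simp only [beginRound]
  cases hmode : N.mode with
  | settled => exact absurd hmode HN.mode_ne_settled
  | explore =>
    cases docked with
    | none =>
      refine .inl ⟨_, rfl, rfl, hNp, ?_⟩
      rw [← hmode]
      cases HN with
      | fresh h1 h2 h3 h4 => exact .fresh h1 h2 h3 h4
      | exploring T R h1 h2 h3 h4 h5 =>
        refine .exploring T R h1 (fun _ hw => ?_) h3 h4 h5
        obtain ⟨j, hj, -⟩ := R.docked w hw
        exact hnone rfl j hj
      | returning T R h1 h2 h3 h4 => simp [hmode] at h2
    | some j =>
      right
      have hj := hsome j rfl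
      by_cases hvis : N.visited j = true
      · simp only [hvis, if_true]
        cases HN with
        | fresh h1 h2 h3 h4 => simp [h4] at hvis
        | @exploring S par cnt v _ rest q _ T R h1 h2 h3 h4 h5 =>
          have hw : w ∈ S := by
            obtain ⟨a, ha, hja⟩ := R.marked j hvis
            exact hD j w a hj hja ▸ ha
          refine ⟨_, v, _, rfl, by simp only [hNp]; exact PortLabeling.through_symm h1, hNc, ?_⟩
          exact .returning (T.retarget hw v) R hNc rfl h4 (by omega)
        | returning T R h1 h2 h3 h4 => simp [hmode] at h2
      · obtain ⟨M', w', e, h1, h2, h3, h4⟩ :=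
          HN.of_firstVisit hG hS hD' hmode hNp hj (by simpa using hvis)
        exact ⟨M', w', e, by simpa [hvis] using h1, h2, h3, h4⟩
  | backtrack =>
    right
    cases HN with
    | fresh h1 h2 h3 h4 => simp [hmode] at h1
    | exploring T R h1 h2 h3 h4 h5 => simp [hmode] at h3
    | @returning S par cnt _ rest _ T R h1 h2 h3 h4 =>
      have hd := T.degree_pos (hS _ _ R) hG w
      have hlast : 0 ≤ lastPort G par cnt w := Int.emod_nonneg _ (by omega)
      have hq : (N.portEntered + 1) % (G.degree w : ℤ) =
          (par w + cnt w + 1) % (G.degree w : ℤ) := by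
        rw [hNp, entryPort, Int.toNat_of_nonneg hlast, lastPort, Int.emod_add_emod]
      simp only [h3, List.map_cons, List.head?_cons, ne_eq, Option.some.injEq, ite_not,
        List.tail_cons]
      by_cases hpar : par w = (N.portEntered + 1) % (G.degree w : ℤ)
      · rw [if_pos hpar]
        let M' : Memory k :=
          { N with portEntered := (N.portEntered + 1) % (G.degree w : ℤ), stack := rest.map par }
        obtain ⟨w', e, hw', -, hP⟩ := next (M := M') hG T R (hS _ _ R) hNc hq h4
        exact ⟨M', w', e, by simp [M', hmode], hw', hNc, hP hpar.symm hmode rfl⟩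
      · rw [if_neg hpar]
        let M' : Memory k :=
          { N with portEntered := (N.portEntered + 1) % (G.degree w : ℤ), mode := .explore }
        obtain ⟨w', e, hw', hP, -⟩ := next (M := M') hG T R (hS _ _ R) hNc hq h4
        exact ⟨M', w', e, by simp [M', h3], hw', hNc, hP (Ne.symm hpar) rfl h3⟩

/-- The beginning of an iteration: the robot calls MUTEX or moves on in its traversal. -/
theorem of_beginRound [DecidableEq V] (hG : G.Connected)
    (hS : ∀ visited S, Recorded D visited S → S ≠ Finset.univ)
    (hD : ∀ j v w, D j v → D j w → v = w) (hD' : ∀ i j v, D i v → D j v → i = j)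
    (H : Phase P r D M w entry mv) (hc : M.contending = false) {docked : Option (Fin k)}
    (hsome : ∀ j, docked = some j → D j w) (hnone : docked = none → ∀ j, ¬ D j w) :
    (∃ M' : Memory k, beginRound M (G.degree w) entry docked = (M', .stay) ∧
      M'.contending = true ∧ M'.portEntered = entryPort entry ∧ Phase P r D M' w entry mv) ∨
    ∃ (M' : Memory k) (w' : V) (e : ℕ),
      beginRound M (G.degree w) entry docked = (M', .moveThrough M'.portEntered) ∧
      P.through w M'.portEntered = some (w', e) ∧
      M'.contending = false ∧ Phase P r D M' w' (some e) (mv + 1) := by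
  have hrec : beginRound M (G.degree w) entry docked =
      beginRound { M with portEntered := entryPort entry } (G.degree w) none docked := by
    cases H with
    | fresh h1 h2 h3 h4 => rw [entryPort, ← h3]
    | exploring T R h1 h2 h3 h4 h5 => simp [beginRound, entryPort, h3]
    | returning T R h1 h2 h3 h4 => simp [beginRound, entryPort, h2]
  rw [hrec]
  exact H.record_entry.of_beginRound_none hG hS hD hD' hc rfl hsome hnone

theorem mode_of_contending (H : Phase P r D M w entry mv) (hc : M.contending = true) :
    M.mode = .explore := by
  cases H <;> simp_all

theorem visited_eq_false_of_contending (H : Phase P r D M w entry mv) (hc : M.contending = true)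
    (hD : ∀ j v w, D j v → D j w → v = w) {j : Fin k} (hj : D j w) : M.visited j = false := by
  cases H with
  | fresh h1 h2 h3 h4 => exact h4 j
  | exploring T R h1 h2 h3 h4 h5 =>
    by_contra hvis
    obtain ⟨v, hv, hjv⟩ := R.marked j (by simpa using hvis)
    exact h2 hc (hD j v w hjv hj ▸ hv)
  | returning T R h1 h2 h3 h4 => simp [hc] at h1

theorem entryPort_bounds (H : Phase P r D M w entry mv) :
    -1 ≤ entryPort entry ∧ entryPort entry ≤ G.degree w := by
  have key : ∀ v p q, P.through v p = some (w, q) →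
      -1 ≤ entryPort (some q) ∧ entryPort (some q) ≤ G.degree w := fun v p q h => by
    have := PortLabeling.entry_lt h
    simp only [entryPort]
    omega
  cases H with
  | fresh => simp only [entryPort]; omega
  | exploring T R h1 h2 h3 h4 h5 => exact key _ _ _ h1
  | @returning S par cnt _ rest _ T R h1 h2 h3 h4 =>
    rcases Nat.eq_zero_or_pos (G.degree w) with hd | hd
    · have hr : w = r := by
        by_contra hwr
        have := T.cnt_lt w (T.path_subset w (by simp)) hwr
        omega
      have hcnt := T.cnt_root
      rw [← hr, hd] at hcnt
      simp only [entryPort, lastPort, hr, T.par_root]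
      rw [← hr, hd, Nat.le_zero.1 hcnt]
      simp
    · have h5 := Int.emod_nonneg (par w + cnt w) (show (G.degree w : ℤ) ≠ 0 by omega)
      have h6 := Int.emod_lt_of_pos (par w + cnt w) (show (0 : ℤ) < G.degree w by omega)
      simp only [entryPort, lastPort, Int.toNat_of_nonneg h5]
      omega

/-- The stack holds the parent ports of the current branch, which consists of visited nodes. -/
theorem stack_bounds (hcard : ∀ visited S, Recorded D visited S → S.card < k)
    (H : Phase P r D M w entry mv) :
    M.stack.length ≤ k ∧ ∀ p ∈ M.stack, -1 ≤ p ∧ p ≤ G.maxDegree := by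
  classical
  have key : ∀ {S par cnt path x}, Traversal P r S par cnt path x → Recorded D M.visited S →
      M.stack = path.map par → M.stack.length ≤ k ∧ ∀ p ∈ M.stack, -1 ≤ p ∧ p ≤ G.maxDegree := by
    intro S par cnt path x T R h
    rw [h]
    constructor
    · rw [List.length_map, ← List.toFinset_card_of_nodup T.branch.nodup]
      refine (Finset.card_le_card fun v hv => ?_).trans (hcard _ _ R).le
      exact T.path_subset v (List.mem_toFinset.1 hv)
    · intro p hp
      obtain ⟨v, hv, rfl⟩ := List.mem_map.1 hp
      have h1 := T.par_bounds (T.path_subset v hv)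
      have h2 := G.degree_le_maxDegree v
      omega
  cases H with
  | fresh h1 h2 h3 h4 => simp [h2]
  | exploring T R h1 h2 h3 h4 h5 => exact key T R h4
  | returning T R h1 h2 h3 h4 => exact key T R h3

theorem moves_le (hG : G.Connected) (hS : ∀ visited S, Recorded D visited S → S ≠ Finset.univ)
    (H : Phase P r D M w entry mv) :
    mv + 2 * Fintype.card V ≤ 4 * G.edgeFinset.card + 2 := by
  classical
  cases H with
  | fresh h1 h2 h3 h4 =>
    have h5 := hG.card_vert_le_card_edgeSet_add_one
    rw [Nat.card_eq_fintype_card, Nat.card_eq_fintype_card, ← SimpleGraph.edgeFinset_card] at h5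
    have h6 : 0 < Fintype.card V := Fintype.card_pos_iff.2 ⟨r⟩
    omega
  | exploring T R h1 h2 h3 h4 h5 =>
    have := T.sum_cnt_le (hS _ _ R) hG
    omega
  | returning T R h1 h2 h3 h4 =>
    have := T.sum_cnt_le (hS _ _ R) hG
    omega

/-- A robot that docks in its next iteration has not made the last of the moves of a complete
traversal, unless it has not moved at all. -/
theorem moves_lt_of_explore (hG : G.Connected)
    (hS : ∀ visited S, Recorded D visited S → S ≠ Finset.univ)
    (H : Phase P r D M w entry mv) (hm : M.mode = .explore) :
    mv = 0 ∨ mv + 1 + 2 * Fintype.card V ≤ 4 * G.edgeFinset.card + 2 := by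
  classical
  cases H with
  | fresh h1 h2 h3 h4 => exact .inl rfl
  | exploring T R h1 h2 h3 h4 h5 =>
    have := T.sum_cnt_le (hS _ _ R) hG
    omega
  | returning T R h1 h2 h3 h4 => simp [hm] at h2

end Phase
end Walk

/-! ### The invariant of an execution -/

section Execution

variable {V : Type u} {k : ℕ}

/-- The variables of a robot take values in a range that depends only on `k` and on a bound `Δ` on
the degrees. -/
structure Memory.Bounded (M : Memory k) (Δ : ℕ) : Prop where
  port : -1 ≤ M.portEntered ∧ M.portEntered ≤ Δ
  length : M.stack.length ≤ k
  stack : ∀ p ∈ M.stack, -1 ≤ p ∧ p ≤ Δ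

theorem Config.DockedAt.node_unique {c : Config V k} {j : Fin k} {v w : V} (hv : c.DockedAt j v)
    (hw : c.DockedAt j w) : v = w :=
  Option.some_injective _ (hv.2.symm.trans hw.2)

theorem Config.dockedAt_of_dockedRobot [DecidableEq V] {c : Config V k} {j : Fin k} {v : V}
    (h : c.dockedRobot v = some j) : c.DockedAt j v := by
  simpa using List.find?_some h

theorem Config.not_dockedAt_of_dockedRobot [DecidableEq V] {c : Config V k} {v : V}
    (h : c.dockedRobot v = none) (j : Fin k) : ¬ c.DockedAt j v := by
  simpa using List.find?_eq_none.1 h j (List.mem_finRange j)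

theorem Config.card_lt_of_recorded {c : Config V k} {i : Fin k} (hi : (c.mem i).mode ≠ .settled)
    (visited : Fin k → Bool) (S : Finset V) (R : Recorded c.DockedAt visited S) : S.card < k :=
  R.card_lt (fun _ _ _ => Config.DockedAt.node_unique) fun _ h => hi h.1

variable [Fintype V] {G : SimpleGraph V} [DecidableRel G.Adj]

theorem Config.ne_univ_of_recorded {c : Config V k} {i : Fin k} (hk : k ≤ Fintype.card V)
    (hi : (c.mem i).mode ≠ .settled) (visited : Fin k → Bool) (S : Finset V)
    (R : Recorded c.DockedAt visited S) : S ≠ Finset.univ := fun h => by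
  have := Config.card_lt_of_recorded hi visited S R
  rw [h, Finset.card_univ] at this
  omega

/-- The invariant of a robot that started at `r`, is at the given place with memory `M`, has made
`mv` moves, begun `rd` iterations, and been activated `act` times before docking. An iteration takes
at most three activations: it begins, MUTEX returns, the robot arrives at the next node. -/
inductive RobotInv (P : PortLabeling G) (r : V) (D : Fin k → V → Prop) (M : Memory k)
    (mv rd act : ℕ) : Place V → Prop
  | onEdge {v w : V} {p : ℤ} {q : ℕ} : P.through v p = some (w, q) → M.contending = false →
      (-1 ≤ M.portEntered ∧ M.portEntered ≤ G.maxDegree) → Phase P r D M w (some q) mv →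
      rd = mv → act + 1 ≤ 3 * rd → RobotInv P r D M mv rd act (.edge v p)
  | atNode {w : V} {entry : Option ℕ} : M.contending = false →
      (-1 ≤ M.portEntered ∧ M.portEntered ≤ G.maxDegree) → Phase P r D M w entry mv →
      rd = mv → act ≤ 3 * rd → RobotInv P r D M mv rd act (.node w entry)
  | contending {w : V} {entry : Option ℕ} : M.contending = true →
      M.portEntered = entryPort entry → Phase P r D M w entry mv →
      rd = mv + 1 → act + 2 ≤ 3 * rd → RobotInv P r D M mv rd act (.node w entry)
  | docked {w : V} {entry : Option ℕ} : M.mode = .settled → M.Bounded G.maxDegree →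
      mv + 2 * Fintype.card V ≤ 4 * G.edgeFinset.card + 2 →
      (rd = 1 ∨ rd + 2 * Fintype.card V ≤ 4 * G.edgeFinset.card + 2) → act ≤ 3 * rd →
      RobotInv P r D M mv rd act (.node w entry)

namespace RobotInv

variable {P : PortLabeling G} {r : V} {D D' : Fin k → V → Prop} {M : Memory k} {mv rd act : ℕ}
  {x : Place V}

theorem mono (H : RobotInv P r D M mv rd act x) (h : ∀ j v, D j v → D' j v) :
    RobotInv P r D' M mv rd act x := by
  cases H with
  | onEdge h1 h2 h3 h4 h5 h6 => exact .onEdge h1 h2 h3 (h4.mono h) h5 h6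
  | atNode h1 h2 h3 h4 h5 => exact .atNode h1 h2 (h3.mono h) h4 h5
  | contending h1 h2 h3 h4 h5 => exact .contending h1 h2 (h3.mono h) h4 h5
  | docked h1 h2 h3 h4 h5 => exact .docked h1 h2 h3 h4 h5

theorem exists_node_of_settled (H : RobotInv P r D M mv rd act x) (hM : M.mode = .settled) :
    ∃ v, x.node? = some v := by
  cases H with
  | onEdge _ _ _ h => exact absurd hM h.mode_ne_settled
  | atNode => exact ⟨_, rfl⟩
  | contending => exact ⟨_, rfl⟩
  | docked => exact ⟨_, rfl⟩

theorem act_le (H : RobotInv P r D M mv rd act x) : act ≤ 3 * rd := by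
  cases H <;> omega

theorem bounded (H : RobotInv P r D M mv rd act x)
    (hcard : M.mode ≠ .settled → ∀ visited S, Recorded D visited S → S.card < k) :
    M.Bounded G.maxDegree := by
  have key : ∀ {w e}, Phase P r D M w e mv → (-1 ≤ M.portEntered ∧ M.portEntered ≤ G.maxDegree) →
      M.Bounded G.maxDegree := fun h hp =>
    ⟨hp, (h.stack_bounds (hcard h.mode_ne_settled)).1,
      (h.stack_bounds (hcard h.mode_ne_settled)).2⟩
  cases H with
  | onEdge h1 h2 h3 h4 h5 h6 => exact key h4 h3
  | atNode h1 h2 h3 h4 h5 => exact key h3 h2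
  | @contending w _ h1 h2 h3 h4 h5 =>
    have h6 := h3.entryPort_bounds
    have h7 := G.degree_le_maxDegree w
    exact key h3 (by omega)
  | docked h1 h2 => exact h2

theorem moves_le (H : RobotInv P r D M mv rd act x) (hG : G.Connected)
    (hS : M.mode ≠ .settled → ∀ visited S, Recorded D visited S → S ≠ Finset.univ) :
    mv + 2 * Fintype.card V ≤ 4 * G.edgeFinset.card + 2 := by
  cases H with
  | onEdge _ _ _ h => exact h.moves_le hG (hS h.mode_ne_settled)
  | atNode _ _ h => exact h.moves_le hG (hS h.mode_ne_settled)
  | contending _ _ h => exact h.moves_le hG (hS h.mode_ne_settled)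
  | docked _ _ h => exact h

theorem rounds_le (H : RobotInv P r D M mv rd act x) (hG : G.Connected)
    (hS : M.mode ≠ .settled → ∀ visited S, Recorded D visited S → S ≠ Finset.univ) :
    rd = 1 ∨ rd + 2 * Fintype.card V ≤ 4 * G.edgeFinset.card + 2 := by
  cases H with
  | onEdge _ _ _ h hrd => exact .inr (hrd ▸ h.moves_le hG (hS h.mode_ne_settled))
  | atNode _ _ h hrd => exact .inr (hrd ▸ h.moves_le hG (hS h.mode_ne_settled))
  | contending hc _ h hrd =>
    rcases h.moves_lt_of_explore hG (hS h.mode_ne_settled) (h.mode_of_contending hc) with h | h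
    · exact .inl (by omega)
    · exact .inr (by omega)
  | docked _ _ _ h => exact h

end RobotInv

/-- The possible effects of an activation of robot `i`. -/
inductive Activation (P : PortLabeling G) (r : V) (c : Config V k) (i : Fin k) (mv : ℕ) :
    Config V k → Prop
  | idle {v : V} {entry : Option ℕ} : c.place i = .node v entry → (c.mem i).mode = .settled →
      Activation P r c i mv c
  | arrive {v w : V} {p : ℤ} {q : ℕ} : (c.mem i).mode ≠ .settled →
      c.place i = .edge v p → P.through v p = some (w, q) →
      Activation P r c i mv { c with place := Function.update c.place i (.node w (some q)) }
  | contend {w : V} {entry : Option ℕ} {M : Memory k} :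
      (c.mem i).mode ≠ .settled → c.place i = .node w entry →
      (c.mem i).contending = false → M.contending = true → M.portEntered = entryPort entry →
      Phase P r c.DockedAt M w entry mv →
      Activation P r c i mv { c with mem := Function.update c.mem i M }
  | move {v w : V} {entry : Option ℕ} {q : ℕ} {M : Memory k} :
      (c.mem i).mode ≠ .settled → c.place i = .node v entry →
      P.through v M.portEntered = some (w, q) → M.contending = false →
      Phase P r c.DockedAt M w (some q) (mv + 1) →
      Activation P r c i mv
        { place := Function.update c.place i (.edge v M.portEntered)
          mem := Function.update c.mem i M }
  | dock {w : V} {entry : Option ℕ} : (c.mem i).mode ≠ .settled → c.place i = .node w entry →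
      (c.mem i).contending = true → (∀ j, ¬ c.DockedAt j w) →
      Activation P r c i mv
        { c with
          mem := Function.update c.mem i { c.mem i with mode := .settled, contending := false } }

namespace Activation

variable {P : PortLabeling G} {r : V} {c c' : Config V k} {i : Fin k} {mv : ℕ}

theorem eq_of_ne (H : Activation P r c i mv c') {j : Fin k} (hj : j ≠ i) :
    c'.place j = c.place j ∧ c'.mem j = c.mem j := by
  cases H <;> simp [hj]

theorem dockedAt_mono (H : Activation P r c i mv c') {j : Fin k} {v : V} (h : c.DockedAt j v) :
    c'.DockedAt j v := by
  by_cases hj : j = i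
  · subst hj
    cases H with
    | idle => exact h
    | arrive hm => exact absurd h.1 hm
    | contend hm => exact absurd h.1 hm
    | move hm => exact absurd h.1 hm
    | dock hm => exact absurd h.1 hm
  · obtain ⟨h1, h2⟩ := H.eq_of_ne hj
    rwa [Config.DockedAt, h1, h2]

/-- A robot docks only at free nodes. -/
theorem dockedAt_cases (H : Activation P r c i mv c') {j : Fin k} {v : V}
    (h : c'.DockedAt j v) : c.DockedAt j v ∨ j = i ∧ ∀ l, ¬ c.DockedAt l v := by
  by_cases hj : j = i
  · subst hj
    have hm := h.1
    cases H with
    | idle => exact .inl h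
    | arrive hm' => exact absurd hm hm'
    | contend _ _ _ _ _ hP => exact absurd (by simpa using hm) hP.mode_ne_settled
    | move _ _ _ _ hP => exact absurd (by simpa using hm) hP.mode_ne_settled
    | dock _ h1 _ h3 =>
      have := h.2
      simp only [h1, Place.node?, Option.some.injEq] at this
      exact .inr ⟨rfl, this ▸ h3⟩
  · obtain ⟨h1, h2⟩ := H.eq_of_ne hj
    rw [Config.DockedAt, h1, h2] at h
    exact .inl h

end Activation

theorem activation [DecidableEq V] {P : PortLabeling G} {r : V} {c : Config V k} {i : Fin k}
    {mv rd act : ℕ} (hG : G.Connected)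
    (hS : (c.mem i).mode ≠ .settled →
      ∀ visited S, Recorded c.DockedAt visited S → S ≠ Finset.univ)
    (hD : ∀ i j v, c.DockedAt i v → c.DockedAt j v → i = j)
    (H : RobotInv P r c.DockedAt (c.mem i) mv rd act (c.place i)) :
    Activation P r c i mv (activate P c i) := by
  have hD' : ∀ j v w, c.DockedAt j v → c.DockedAt j w → v = w := fun j v w =>
    Config.DockedAt.node_unique
  generalize hx : c.place i = x at H
  cases H with
  | onEdge h1 h2 h3 h4 h5 h6 =>
    simp only [activate, hx, h1]
    exact .arrive h4.mode_ne_settled hx h1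
  | @atNode w entry h1 h2 h3 h4 h5 =>
    have hm := h3.mode_ne_settled
    simp only [activate, hx, hm, if_false, h1, Bool.false_eq_true]
    rcases h3.of_beginRound hG (hS hm) hD' hD h1 (docked := c.dockedRobot w)
      (fun j => Config.dockedAt_of_dockedRobot) Config.not_dockedAt_of_dockedRobot with
      ⟨M', hM', hc, hp, hP⟩ | ⟨M', w', e, hM', hw', hc, hP⟩
    · rw [hM']
      exact .contend hm hx h1 hc hp hP
    · rw [hM']
      exact .move hm hx hw' hc hP
  | @contending w entry h1 h2 h3 h4 h5 =>
    have hm := h3.mode_ne_settled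
    simp only [activate, hx, hm, if_false, h1, if_true]
    cases hr : c.dockedRobot w with
    | none =>
      simp only [Option.getD_none, afterMutex, if_true]
      exact .dock hm hx h1 (Config.not_dockedAt_of_dockedRobot hr)
    | some j =>
      have hj := Config.dockedAt_of_dockedRobot hr
      have hij : i ≠ j := fun h => hm (h ▸ hj.1)
      obtain ⟨M', w', e, hM', hw', hc, hP⟩ := h3.of_firstVisit hG (hS hm) hD
        (h3.mode_of_contending h1) h2 hj (h3.visited_eq_false_of_contending h1 hD' hj)
      simp only [Option.getD_some, afterMutex, if_neg hij, hM']
      exact .move hm hx hw' hc hP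
  | docked h1 h2 h3 h4 =>
    simp only [activate, hx, h1, if_true]
    exact .idle hx h1

/-- The invariant of a configuration, with counters as in `RobotInv`. -/
structure Inv (P : PortLabeling G) (start : Fin k → V) (c : Config V k) (mv rd act : Fin k → ℕ) :
    Prop where
  robot_unique : ∀ i j v, c.DockedAt i v → c.DockedAt j v → i = j
  robot : ∀ i, RobotInv P (start i) c.DockedAt (c.mem i) (mv i) (rd i) (act i) (c.place i)

namespace Inv

variable {P : PortLabeling G} {start : Fin k → V} {c : Config V k} {mv rd act : Fin k → ℕ}

variable (P start) in
theorem init : Inv P start (Config.init start) (fun _ => 0) (fun _ => 0) (fun _ => 0) where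
  robot_unique i j v h := by cases h.1
  robot i := .atNode rfl ⟨le_rfl, by simp only [Config.init, Memory.init]; omega⟩
    (.fresh rfl rfl rfl fun _ => rfl) rfl le_rfl

open Classical in
theorem activate [DecidableEq V] (H : Inv P start c mv rd act) (hG : G.Connected)
    (hk : k ≤ Fintype.card V) (a : Fin k) :
    Inv P start (activate P c a)
      (fun i => mv i + if (c.place i).node?.isSome = true ∧
        ((Dispersion.activate P c a).place i).node? = none then 1 else 0)
      (fun i => rd i + if a = i ∧ c.AtRoundStart i then 1 else 0)
      (fun i => act i + if a = i ∧ (c.mem i).mode ≠ .settled then 1 else 0) := by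
  have hA := activation hG (Config.ne_univ_of_recorded hk) H.robot_unique (H.robot a)
  have hmono := fun j v => hA.dockedAt_mono (j := j) (v := v)
  refine ⟨fun i j v hi hj => ?_, fun i => ?_⟩
  · rcases hA.dockedAt_cases hi with hi | ⟨hia, hi'⟩ <;>
      rcases hA.dockedAt_cases hj with hj | ⟨hja, hj'⟩
    · exact H.robot_unique i j v hi hj
    · exact absurd hi (hj' i)
    · exact absurd hj (hi' j)
    · rw [hia, hja]
  have hR := H.robot i
  by_cases hia : a = i
  swap
  · obtain ⟨hp, hm⟩ := hA.eq_of_ne (Ne.symm hia)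
    rw [hp, hm, if_neg (by cases (c.place i).node? <;> simp), if_neg (by simp [hia]),
      if_neg (by simp [hia])]
    exact hR.mono hmono
  subst hia
  generalize Dispersion.activate P c a = c' at hA hmono
  generalize hx : c.place a = x at hR
  cases hA with
  | idle h1 h2 =>
    rw [h1, if_neg (by simp [Place.node?]), if_neg (by simp [Config.AtRoundStart, h2]),
      if_neg (by simp [h2])]
    rw [← hx, h1] at hR
    exact hR
  | @arrive v w p q hm h1 h2 =>
    rw [hx] at h1
    subst h1
    cases hR with
    | onEdge h3 h4 h5 h6 h7 h8 =>
      rw [h2] at h3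
      simp only [Option.some.injEq, Prod.mk.injEq] at h3
      obtain ⟨rfl, rfl⟩ := h3
      simp only [Function.update_self, true_and]
      rw [if_neg (by simp [Place.node?]), if_neg (by simp [Config.AtRoundStart, hx, Place.node?]),
        if_pos hm]
      exact .atNode h4 h5 (h6.mono hmono) h7 h8
  | @contend w entry M hm h1 h2 h3 h4 h5 =>
    rw [hx] at h1
    subst h1
    cases hR with
    | atNode h6 h7 h8 h9 h10 =>
      simp only [hx, Function.update_self, true_and]
      rw [if_neg (by simp [Place.node?]),
        if_pos ⟨by simp [hx, Place.node?], hm, h2⟩, if_pos hm]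
      exact .contending h3 h4 (h5.mono hmono) (by omega) (by omega)
    | contending h6 => simp [h2] at h6
    | docked h6 => exact absurd h6 hm
  | @move v w entry q M hm h1 h2 h3 h4 =>
    rw [hx] at h1
    subst h1
    have hb := PortLabeling.bounds_of_through h2
    have hd := G.degree_le_maxDegree v
    simp only [Function.update_self, true_and]
    rw [if_pos (by simp [Place.node?]), if_pos hm]
    cases hR with
    | atNode h6 h7 h8 h9 h10 =>
      rw [if_pos ⟨by simp [hx, Place.node?], hm, h6⟩]
      exact .onEdge h2 h3 (by omega) (h4.mono hmono) (by omega) (by omega)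
    | contending h6 h7 h8 h9 h10 =>
      rw [if_neg (by simp [Config.AtRoundStart, h6])]
      exact .onEdge h2 h3 (by omega) (h4.mono hmono) (by omega) (by omega)
    | docked h6 => exact absurd h6 hm
  | @dock w entry hm h1 h2 h3 =>
    have hB := hR.bounded fun _ => Config.card_lt_of_recorded hm
    have hmv := hR.moves_le hG fun _ => Config.ne_univ_of_recorded hk hm
    have hrd := hR.rounds_le hG fun _ => Config.ne_univ_of_recorded hk hm
    rw [hx] at h1
    subst h1
    simp only [hx, Function.update_self, true_and]
    rw [if_neg (by simp [Place.node?]), if_neg (by simp [Config.AtRoundStart, h2]),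
      if_pos hm]
    refine .docked rfl ⟨hB.port, hB.length, hB.stack⟩ hmv hrd ?_
    cases hR with
    | atNode h6 => simp [h2] at h6
    | contending h6 h7 h8 h9 h10 => omega
    | docked h6 => exact absurd h6 hm

end Inv
end Execution

/-! ### Executions -/

section Run

variable {V : Type u} [Fintype V] [DecidableEq V] {G : SimpleGraph V} [DecidableRel G.Adj] {k : ℕ}

open Classical in
/-- The number of activations of robot `i` before it docks, in the first `t` activations. -/
noncomputable def activeSteps (P : PortLabeling G) (start : Fin k → V) (σ : ℕ → Fin k) (i : Fin k)
    (t : ℕ) : ℕ :=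
  ((Finset.range t).filter
    (fun s => σ s = i ∧ ((run P start σ s).mem i).mode ≠ .settled)).card

theorem card_filter_range_succ (p : ℕ → Prop) [DecidablePred p] (t : ℕ) :
    ((Finset.range (t + 1)).filter p).card =
      ((Finset.range t).filter p).card + if p t then 1 else 0 := by
  rw [Finset.range_add_one, Finset.filter_insert]
  split_ifs
  · exact Finset.card_insert_of_notMem (by simp)
  · rfl

variable {P : PortLabeling G} {start : Fin k → V} {σ : ℕ → Fin k}

open Classical in
theorem moves_succ (i : Fin k) (t : ℕ) : moves P start σ i (t + 1) = moves P start σ i t +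
    if ((run P start σ t).place i).node?.isSome = true ∧
      ((activate P (run P start σ t) (σ t)).place i).node? = none then 1 else 0 := by
  unfold moves
  convert card_filter_range_succ (fun s => ((run P start σ s).place i).node?.isSome = true ∧
    ((run P start σ (s + 1)).place i).node? = none) t
  rfl

open Classical in
theorem rounds_succ (i : Fin k) (t : ℕ) : rounds P start σ i (t + 1) = rounds P start σ i t +
    if σ t = i ∧ (run P start σ t).AtRoundStart i then 1 else 0 :=
  card_filter_range_succ (fun s => σ s = i ∧ (run P start σ s).AtRoundStart i) t

open Classical in
theorem activeSteps_succ (i : Fin k) (t : ℕ) :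
    activeSteps P start σ i (t + 1) = activeSteps P start σ i t +
      if σ t = i ∧ ((run P start σ t).mem i).mode ≠ .settled then 1 else 0 := by
  unfold activeSteps
  convert card_filter_range_succ
    (fun s => σ s = i ∧ ((run P start σ s).mem i).mode ≠ .settled) t

theorem inv_run (hG : G.Connected) (hk : k ≤ Fintype.card V) (t : ℕ) :
    Inv P start (run P start σ t) (fun i => moves P start σ i t) (fun i => rounds P start σ i t)
      (fun i => activeSteps P start σ i t) := by
  induction t with
  | zero => exact Inv.init P start
  | succ t ih =>
    simp only [moves_succ, rounds_succ, activeSteps_succ]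
    convert ih.activate hG hk (σ t)
    rfl

theorem dockedAt_run_mono (hG : G.Connected) (hk : k ≤ Fintype.card V) {s t : ℕ} (hst : s ≤ t)
    {i : Fin k} {v : V} (h : (run P start σ s).DockedAt i v) :
    (run P start σ t).DockedAt i v := by
  induction t, hst using Nat.le_induction with
  | base => exact h
  | succ t _ ih =>
    have H := inv_run (P := P) (start := start) (σ := σ) hG hk t
    exact (activation hG (Config.ne_univ_of_recorded hk) H.robot_unique
      (H.robot (σ t))).dockedAt_mono ih

theorem activate_of_dockedAt {c : Config V k} {i : Fin k} {v : V} (h : c.DockedAt i v) :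
    activate P c i = c := by
  have h2 := h.2
  unfold activate
  cases hx : c.place i with
  | edge => simp [hx, Place.node?] at h2
  | node => simp [h.1]

/-- Every robot docks in a fair execution: the number of its activations before docking is bounded
by three times the number of its iterations. -/
theorem exists_dockedAt (hG : G.Connected) (hk : k ≤ Fintype.card V) (hσ : Fair σ) (i : Fin k) :
    ∃ t v, (run P start σ t).DockedAt i v := by
  classical
  have H := fun t => inv_run (P := P) (start := start) (σ := σ) hG hk t
  by_contra! hnot
  have hm : ∀ t, ((run P start σ t).mem i).mode ≠ .settled := fun t hs => by
    obtain ⟨v, hv⟩ := ((H t).robot i).exists_node_of_settled hs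
    exact hnot t v ⟨hs, hv⟩
  have hunb : ∀ N, ∃ t, N ≤ activeSteps P start σ i t := fun N => by
    induction N with
    | zero => exact ⟨0, Nat.zero_le _⟩
    | succ N ih =>
      obtain ⟨t, ht⟩ := ih
      obtain ⟨s, hts, hs⟩ := hσ i t
      refine ⟨s + 1, ?_⟩
      have hmono : activeSteps P start σ i t ≤ activeSteps P start σ i s :=
        Finset.card_le_card (Finset.filter_subset_filter _ (Finset.range_mono hts))
      have hsucc : activeSteps P start σ i (s + 1) = activeSteps P start σ i s + 1 := by
        refine (activeSteps_succ i s).trans ?_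
        rw [if_pos ⟨hs, hm s⟩]
      omega
  obtain ⟨t, ht⟩ := hunb (3 * (4 * G.edgeFinset.card + 3) + 1)
  have h1 := ((H t).robot i).act_le
  have h2 := ((H t).robot i).rounds_le hG (Config.ne_univ_of_recorded hk)
  omega

theorem exists_final (hG : G.Connected) (hk : k ≤ Fintype.card V) (hσ : Fair σ) :
    ∃ (T : ℕ) (final : Fin k → V), Function.Injective final ∧
      (∀ i, (run P start σ T).DockedAt i (final i)) ∧
      ∀ t, T ≤ t → run P start σ t = run P start σ T := by
  choose τ final hfinal using exists_dockedAt (P := P) (start := start) hG hk hσ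
  have hd : ∀ t, Finset.univ.sup τ ≤ t → ∀ i, (run P start σ t).DockedAt i (final i) :=
    fun t ht i => dockedAt_run_mono hG hk ((Finset.le_sup (Finset.mem_univ i)).trans ht) (hfinal i)
  refine ⟨Finset.univ.sup τ, final, fun i j hij => ?_, hd _ le_rfl, fun t ht => ?_⟩
  · exact (inv_run hG hk (Finset.univ.sup τ)).robot_unique i j (final i) (hd _ le_rfl i)
      (hij ▸ hd _ le_rfl j)
  · induction t, ht using Nat.le_induction with
    | base => rfl
    | succ t ht ih => rw [← ih, run, activate_of_dockedAt (hd t ht (σ t))]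

end Run

/-! ### Memory -/

instance : Fintype Mode := ⟨{.explore, .backtrack, .settled}, fun m => by cases m <;> decide⟩

/-- A port, shifted by one, as an element of a finite type. -/
def portCode (Δ : ℕ) (p : ℤ) : Fin (Δ + 3) := Fin.ofNat (Δ + 3) (p + 1).toNat

theorem portCode_injOn (Δ : ℕ) {p q : ℤ} (hp : -1 ≤ p ∧ p ≤ Δ) (hq : -1 ≤ q ∧ q ≤ Δ)
    (h : portCode Δ p = portCode Δ q) : p = q := by
  have h := congrArg Fin.val h
  simp only [portCode, Fin.ofNat] at h
  rw [Nat.mod_eq_of_lt (by omega), Nat.mod_eq_of_lt (by omega)] at h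
  omega

theorem portCode_ne_last (Δ : ℕ) {p : ℤ} (hp : -1 ≤ p ∧ p ≤ Δ) : portCode Δ p ≠ Fin.last _ := by
  intro h
  have h := congrArg Fin.val h
  simp only [portCode, Fin.ofNat, Fin.val_last] at h
  rw [Nat.mod_eq_of_lt (by omega)] at h
  omega

/-- The contents of a stack, padded to `k` entries by the value that codes no port. -/
def stackCode (k Δ : ℕ) (l : List ℤ) (n : Fin k) : Fin (Δ + 3) :=
  (l[(n : ℕ)]?).elim (Fin.last _) (portCode Δ)

theorem stackCode_injOn {k Δ : ℕ} {l l' : List ℤ} (hl : l.length ≤ k) (hl' : l'.length ≤ k)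
    (hp : ∀ p ∈ l, -1 ≤ p ∧ p ≤ Δ) (hp' : ∀ p ∈ l', -1 ≤ p ∧ p ≤ Δ)
    (h : stackCode k Δ l = stackCode k Δ l') : l = l' := by
  refine List.ext_getElem? fun n => ?_
  by_cases hn : n < k
  · have hn := congrFun h ⟨n, hn⟩
    simp only [stackCode] at hn
    cases hx : l[n]? <;> cases hy : l'[n]? <;> rw [hx, hy] at hn
    · exact absurd hn.symm (portCode_ne_last Δ (hp' _ (List.mem_of_getElem? hy)))
    · exact absurd hn (portCode_ne_last Δ (hp _ (List.mem_of_getElem? hx)))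
    · rw [portCode_injOn Δ (hp _ (List.mem_of_getElem? hx)) (hp' _ (List.mem_of_getElem? hy)) hn]
  · rw [List.getElem?_eq_none (by omega), List.getElem?_eq_none (by omega)]

/-- The label and the memory of a robot as an element of a finite type. -/
def stateCode (k Δ : ℕ) (x : Fin k × Memory k) :
    Fin k × Fin (Δ + 3) × Mode × (Fin k → Bool) × (Fin k → Fin (Δ + 3)) × Bool :=
  (x.1, portCode Δ x.2.portEntered, x.2.mode, x.2.visited, stackCode k Δ x.2.stack, x.2.contending)

theorem stateCode_injOn (k Δ : ℕ) : Set.InjOn (stateCode k Δ) {x | x.2.Bounded Δ} := by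
  rintro ⟨i, M⟩ hM ⟨j, N⟩ hN h
  simp only [stateCode, Prod.mk.injEq] at h
  obtain ⟨rfl, h1, h2, h3, h4, h5⟩ := h
  have h1 := portCode_injOn Δ hM.port hN.port h1
  have h4 := stackCode_injOn hM.length hN.length hM.stack hN.stack h4
  cases M
  cases N
  simp_all

theorem bounded_of_mem_storedStates {k Δ : ℕ} {x : Fin k × Memory k}
    (hx : x ∈ storedStates.{u} k Δ) : x.2.Bounded Δ := by
  obtain ⟨V, _, _, G, _, P, start, σ, i, t, hG, hk, rfl, rfl⟩ := hx
  exact ((inv_run hG hk t).robot i).bounded Config.card_lt_of_recorded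

theorem card_stateCode_le (k Δ : ℕ) :
    Fintype.card (Fin k × Fin (Δ + 3) × Mode × (Fin k → Bool) × (Fin k → Fin (Δ + 3)) × Bool) ≤
      2 ^ (2 * k + 3 + (k + 1) * (Nat.log 2 Δ + 3)) := by
  have hΔ : Δ + 3 ≤ 2 ^ (Nat.log 2 Δ + 3) := by
    have h1 := Nat.lt_pow_succ_log_self (b := 2) one_lt_two Δ
    have h2 : 1 ≤ 2 ^ Nat.log 2 Δ := Nat.one_le_two_pow
    rw [Nat.succ_eq_add_one, pow_succ] at h1
    rw [pow_add]
    omega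
  have hmode : Fintype.card Mode ≤ 2 ^ 2 := by decide
  simp only [Fintype.card_prod, Fintype.card_fun, Fintype.card_fin, Fintype.card_bool]
  calc k * ((Δ + 3) * (Fintype.card Mode * (2 ^ k * ((Δ + 3) ^ k * 2))))
      ≤ 2 ^ k * (2 ^ (Nat.log 2 Δ + 3) * (2 ^ 2 * (2 ^ k * ((2 ^ (Nat.log 2 Δ + 3)) ^ k * 2)))) := by
        gcongr
        exact Nat.lt_two_pow_self.le
    _ = 2 ^ (2 * k + 3 + (k + 1) * (Nat.log 2 Δ + 3)) := by
        rw [← pow_mul]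
        ring

theorem bitsSuffice_of_card_le {k Δ B : ℕ}
    (h : Fintype.card
      (Fin k × Fin (Δ + 3) × Mode × (Fin k → Bool) × (Fin k → Fin (Δ + 3)) × Bool) ≤ 2 ^ B) :
    BitsSuffice.{u} k Δ B := by
  obtain ⟨f⟩ := Function.Embedding.nonempty_of_card_le
    (h.trans_eq (show 2 ^ B = Fintype.card (Fin B → Bool) by simp))
  exact ⟨fun x => f (stateCode k Δ x), fun x hx y hy hxy =>
    stateCode_injOn k Δ (bounded_of_mem_storedStates hx) (bounded_of_mem_storedStates hy)
      (f.injective hxy)⟩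

theorem exists_bitsSuffice (k Δ : ℕ) : ∃ B : ℕ,
    (B : ℝ) ≤ 13 * (k * max 1 (Real.logb 2 Δ)) ∧ BitsSuffice.{u} k Δ B := by
  rcases Nat.eq_zero_or_pos k with rfl | hk
  · exact ⟨0, by simp, bitsSuffice_of_card_le (by simp)⟩
  · refine ⟨_, ?_, bitsSuffice_of_card_le (card_stateCode_le k Δ)⟩
    have h1 : (Nat.log 2 Δ : ℝ) ≤ max 1 (Real.logb 2 Δ) :=
      (by exact_mod_cast Real.natLog_le_logb Δ 2 : (Nat.log 2 Δ : ℝ) ≤ Real.logb 2 Δ).trans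
        (le_max_right _ _)
    have h2 : (1 : ℝ) ≤ max 1 (Real.logb 2 Δ) := le_max_left _ _
    have hk' : (1 : ℝ) ≤ k := by exact_mod_cast hk
    generalize max 1 (Real.logb 2 (Δ : ℝ)) = L at h1 h2 ⊢
    push_cast
    -- `2k + 3 ≤ 5kL` and `(k + 1) (log Δ + 3) ≤ 2k · 4L`
    have h3 : (k : ℝ) ≤ k * L := le_mul_of_one_le_right (by positivity) h2
    have h4 : ((k : ℝ) + 1) * (Nat.log 2 Δ + 3) ≤ (2 * k) * (4 * L) := by
      gcongr <;> linarith
    linarith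

end Dispersion

theorem theorem4 :
    -- dispersion, and the number of steps
    (∀ (V : Type u) [Fintype V] [DecidableEq V] (G : SimpleGraph V) [DecidableRel G.Adj]
      (P : Dispersion.PortLabeling G) (k : ℕ) (start : Fin k → V) (σ : ℕ → Fin k),
      G.Connected → k ≤ Fintype.card V →
      -- at every time there is at most one docked robot at a node
      (∀ (t : ℕ) (i j : Fin k) (v : V),
        (Dispersion.run P start σ t).DockedAt i v →
        (Dispersion.run P start σ t).DockedAt j v → i = j) ∧
      -- a docked robot stays docked at its node forever
      (∀ (s t : ℕ) (i : Fin k) (v : V), s ≤ t →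
        (Dispersion.run P start σ s).DockedAt i v →
        (Dispersion.run P start σ t).DockedAt i v) ∧
      -- every robot makes at most `4m - 2n + 2` moves
      (∀ (i : Fin k) (t : ℕ),
        (Dispersion.moves P start σ i t : ℤ) ≤
          4 * (G.edgeFinset.card : ℤ) - 2 * (Fintype.card V : ℤ) + 2) ∧
      -- and at most `4m - 2n + 2` iterations, the one in which it docks included
      -- (one iteration if `n = 1`)
      (∀ (i : Fin k) (t : ℕ),
        (Dispersion.rounds P start σ i t : ℤ) ≤
          max 1 (4 * (G.edgeFinset.card : ℤ) - 2 * (Fintype.card V : ℤ) + 2)) ∧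
      -- if no robot is delayed forever, a final configuration is reached, in which all robots are
      -- docked, at pairwise distinct nodes
      (Dispersion.Fair σ →
        ∃ (T : ℕ) (final : Fin k → V), Function.Injective final ∧
          (∀ i, (Dispersion.run P start σ T).DockedAt i (final i)) ∧
          ∀ t, T ≤ t → Dispersion.run P start σ t = Dispersion.run P start σ T)) ∧
    -- memory
    (∃ C : ℝ, ∀ k Δ : ℕ, ∃ B : ℕ,
      (B : ℝ) ≤ C * (k * max 1 (Real.logb 2 Δ)) ∧ Dispersion.BitsSuffice.{u} k Δ B) := by
  refine ⟨fun V _ _ G _ P k start σ hG hk => ?_, 13, Dispersion.exists_bitsSuffice⟩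
  have H := fun t => Dispersion.inv_run (P := P) (start := start) (σ := σ) hG hk t
  refine ⟨fun t => (H t).robot_unique, fun s t i v hst => Dispersion.dockedAt_run_mono hG hk hst,
    fun i t => ?_, fun i t => ?_, Dispersion.exists_final hG hk⟩
  · have := ((H t).robot i).moves_le hG (Dispersion.Config.ne_univ_of_recorded hk)
    omega
  · have := ((H t).robot i).rounds_le hG (Dispersion.Config.ne_univ_of_recorded hk)
    omega
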